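/- Work over $\mathbb{C}$ and let $n\ge 2$. A rational normal curve in $\mathbb{P}^n$ is the image of $\mathbb{P}^1$ under a map $[s:t]\mapsto[F_0(s,t):\dots:F_n(s,t)]$, where $F_0,\dots,F_n$ is a basis of the space of binary forms of degree $n$ (a non-degenerate, linearly normal embedding of $\mathbb{P}^1$); it is $(n-1)$-secant to a linear space $\Lambda\subset\mathbb{P}^n$ if $\mathcal{C}\cap\Lambda$ consists of exactly $n-1$ distinct points. Let $G(n-2,\mathbb{P}^n)$ be the Grassmannian of codimension two linear subspaces of $\mathbb{P}^n$. **Proposition.** There is a non-empty Zariski open subset $U\subset G(n-2,\mathbb{P}^n)\times(\mathbb{P}^n)^{n+2}$ such that for every $(\Lambda,P_1,\dots,P_{n+2})\in U$ there exists a unique rational normal curve $\mathcal{C}\subset\mathbb{P}^n$ that passes through $P_1,\dots,P_{n+2}$ and is $(n-1)$-secant to $\Lambda$. -/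

import Mathlib

open scoped LinearAlgebra.Projectivization

namespace RNC

/-- The set of closed points of the complex projective space `ℙⁿ`. -/
abbrev PSpace (n : ℕ) : Type := ℙ ℂ (Fin (n + 1) → ℂ)

/-- The image in `ℙⁿ` of the projective line under `[s : t] ↦ [F₀(s, t) : … : Fₙ(s, t)]`. -/
def imageOfLine {n : ℕ} (F : Fin (n + 1) → MvPolynomial (Fin 2) ℂ) : Set (PSpace n) :=
  {x | ∃ u : Fin 2 → ℂ, u ≠ 0 ∧
    ∃ h : (fun i => MvPolynomial.eval u (F i)) ≠ 0, x = Projectivization.mk ℂ _ h}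

/-- A rational normal curve in `ℙⁿ` is a linearly normal embedded projective line (not contained
in a hyperplane): the image of `ℙ¹` under the complete linear system of binary forms of degree
`n`, that is, under the map given by a basis of the space of all these forms. The members of such
a basis have no common zero on `ℙ¹`. A curve is reduced, so it is determined by its set of
points. -/
def IsRationalNormalCurve {n : ℕ} (C : Set (PSpace n)) : Prop :=
  ∃ F : Module.Basis (Fin (n + 1)) ℂ (MvPolynomial.homogeneousSubmodule (Fin 2) ℂ n),
    C = imageOfLine (fun i => (F i : MvPolynomial (Fin 2) ℂ))

/-- The points of `ℙⁿ` on the linear space `ℙ(W)`. -/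
def pointsOf {n : ℕ} (W : Submodule ℂ (Fin (n + 1) → ℂ)) : Set (PSpace n) :=
  {x | x.submodule ≤ W}

/-- `ℙ(W)` is `k`-secant to `C` if it meets `C` in exactly `k` distinct points. -/
def IsSecant {n : ℕ} (k : ℕ) (W : Submodule ℂ (Fin (n + 1) → ℂ)) (C : Set (PSpace n)) : Prop :=
  (pointsOf W ∩ C).encard = k

/-- The data space `G(n - 2, ℙⁿ) × (ℙⁿ)ᵖ`: a codimension two linear space of `ℙⁿ`, given by a
linear subspace of codimension two of `ℂⁿ⁺¹`, together with an ordered `p`-tuple of points. -/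
structure Datum (n p : ℕ) where
  space : Submodule ℂ (Fin (n + 1) → ℂ)
  codim_two : Module.finrank ℂ space + 2 = n + 1
  point : Fin p → PSpace n

/-- `(A, v)` are homogeneous coordinates of the datum `δ`: the two rows of `A` are (necessarily
linearly independent) linear forms defining the linear space, and `v i` is a nonzero vector on the
line that is the `i`-th point. -/
def Datum.HasCoords {n p : ℕ} (δ : Datum n p) (A : Matrix (Fin 2) (Fin (n + 1)) ℂ)
    (v : Fin p → Fin (n + 1) → ℂ) : Prop :=
  δ.space = LinearMap.ker A.mulVecLin ∧
    ∀ i, ∃ h : v i ≠ 0, δ.point i = Projectivization.mk ℂ (v i) h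

/-- Polynomials in the entries of `A` and `v`. -/
abbrev CoordPoly (n p : ℕ) : Type :=
  MvPolynomial ((Fin 2 × Fin (n + 1)) ⊕ (Fin p × Fin (n + 1))) ℂ

/-- Value of such a polynomial. -/
noncomputable def CoordPoly.value {n p : ℕ} (f : CoordPoly n p)
    (A : Matrix (Fin 2) (Fin (n + 1)) ℂ) (v : Fin p → Fin (n + 1) → ℂ) : ℂ :=
  MvPolynomial.eval (Sum.elim (fun q => A q.1 q.2) (fun q => v q.1 q.2)) f

/-- The Zariski topology of the data space. The data space is the quotient of the Zariski open set
of all coordinates `(A, v)` (two independent linear forms and `p` nonzero vectors) in an affine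
space by the group `GL₂ × (ℂˣ)ᵖ`. Accordingly a set of data is open if and only if the coordinates
of its members are cut out, among all coordinates of data, by the nonvanishing of at least one
polynomial of some set `S`. -/
instance zariskiTopology (n p : ℕ) : TopologicalSpace (Datum n p) where
  IsOpen U := ∃ S : Set (CoordPoly n p), ∀ δ A v, δ.HasCoords A v →
    (δ ∈ U ↔ ∃ f ∈ S, f.value A v ≠ 0)
  isOpen_univ := ⟨{1}, fun δ A v _ => by simp [CoordPoly.value]⟩
  isOpen_inter := by
    rintro U V ⟨S, hS⟩ ⟨T, hT⟩
    refine ⟨{h | ∃ f ∈ S, ∃ g ∈ T, h = f * g}, fun δ A v hδ => ?_⟩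
    rw [Set.mem_inter_iff, hS δ A v hδ, hT δ A v hδ]
    constructor
    · rintro ⟨⟨f, hf, hf0⟩, ⟨g, hg, hg0⟩⟩
      refine ⟨f * g, ⟨f, hf, g, hg, rfl⟩, ?_⟩
      simp only [CoordPoly.value, map_mul] at *
      exact mul_ne_zero hf0 hg0
    · rintro ⟨_, ⟨f, hf, g, hg, rfl⟩, h0⟩
      simp only [CoordPoly.value, map_mul] at *
      exact ⟨⟨f, hf, left_ne_zero_of_mul h0⟩, ⟨g, hg, right_ne_zero_of_mul h0⟩⟩
  isOpen_sUnion := by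
    intro 𝒰 h𝒰
    choose S hS using h𝒰
    refine ⟨{f | ∃ U, ∃ hU : U ∈ 𝒰, f ∈ S U hU}, fun δ A v hδ => ?_⟩
    constructor
    · rintro ⟨U, hU, hδU⟩
      obtain ⟨f, hf, hf0⟩ := (hS U hU δ A v hδ).1 hδU
      exact ⟨f, ⟨U, hU, hf⟩, hf0⟩
    · rintro ⟨f, ⟨U, hU, hf⟩, hf0⟩
      exact ⟨U, hU, (hS U hU δ A v hδ).2 ⟨f, hf, hf0⟩⟩

end RNC

/-!
The idea is that projection from `Λ` parametrizes the curve. Let `Λ` be the kernel of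
`A : ℂⁿ⁺¹ → ℂ²` and let `[v i]` be the given points. If a rational normal curve `Φ` meets `Λ` in
`n - 1` points, then `A ∘ Φ` is a pair of binary forms of degree `n` with `n - 1` common zeros, hence
a form of degree `n - 1` times a linear map `ℂ² → ℂ²`. This map is invertible because the points
`A (v i)` of the line are distinct, so after a reparametrization `A (Φ x)` is proportional to `x`
(`exists_reparametrization`). The parameter of `[v i]` is then `A (v i)`, and a vector of forms of
degree `n` is determined up to a factor by the images of `n + 2` parameters
(`Interpolates.exists_eq_smul`). This gives uniqueness.

Conversely, let `curve` be the parametrized curve of degree `n` taking `A (v i)` to `[v i]`; it is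
given by Lagrange interpolation, with weights from Cramer's rule. A computation shows that
`A (curve x)` is always proportional to `x` (`bracket_mulVec_curve`). So `A ∘ curve` is a form of
degree `n - 1` times the identity, and the curve is `(n - 1)`-secant to `Λ` as soon as this form has
distinct zeros.

All requirements follow from the nonvanishing of one polynomial in the coordinates, `obstruction`;
distinctness of zeros is expressed by a resultant. The data which have some coordinates with
nonzero `obstruction` form an open set, since it is the union of the translates of a principal
open set by changes of coordinates. It is not empty: it contains points of the standard rational
normal curve together with linear forms which restrict to `x₀ (x₀ⁿ⁻¹ + x₁ⁿ⁻¹)` and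
`x₁ (x₀ⁿ⁻¹ + x₁ⁿ⁻¹)`.
-/

namespace RNC

open Matrix

/-! ### Binary forms -/

/-- The determinant of two vectors of `R²`; as a function of `x`, the linear form vanishing at the
point `y` of the projective line. -/
def bracket {R : Type*} [CommRing R] (x y : Fin 2 → R) : R := x 0 * y 1 - x 1 * y 0

@[simp] lemma bracket_self {R : Type*} [CommRing R] (x : Fin 2 → R) : bracket x x = 0 := by
  simp [bracket, mul_comm]

lemma bracket_swap {R : Type*} [CommRing R] (x y : Fin 2 → R) : bracket x y = -bracket y x := by
  simp only [bracket]; ring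

@[simp] lemma bracket_smul_right {R : Type*} [CommRing R] (c : R) (x y : Fin 2 → R) :
    bracket x (c • y) = c * bracket x y := by
  simp only [bracket, Pi.smul_apply, smul_eq_mul]; ring

@[simp] lemma bracket_smul_left {R : Type*} [CommRing R] (c : R) (x y : Fin 2 → R) :
    bracket (c • x) y = c * bracket x y := by
  simp only [bracket, Pi.smul_apply, smul_eq_mul]; ring

@[simp] lemma bracket_zero_left {R : Type*} [CommRing R] (y : Fin 2 → R) : bracket 0 y = 0 := by
  simp [bracket]

lemma bracket_sum_right {R ι : Type*} [CommRing R] (s : Finset ι) (x : Fin 2 → R)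
    (y : ι → Fin 2 → R) : bracket x (∑ i ∈ s, y i) = ∑ i ∈ s, bracket x (y i) := by
  simp [bracket, Finset.mul_sum, Finset.sum_sub_distrib]

lemma bracket_sum_left {R ι : Type*} [CommRing R] (s : Finset ι) (x : Fin 2 → R)
    (y : ι → Fin 2 → R) : bracket (∑ i ∈ s, y i) x = ∑ i ∈ s, bracket (y i) x := by
  simp [bracket, Finset.sum_mul, Finset.sum_sub_distrib]

lemma bracket_mulVec {R : Type*} [CommRing R] (M : Matrix (Fin 2) (Fin 2) R) (x y : Fin 2 → R) :
    bracket (M *ᵥ x) (M *ᵥ y) = M.det * bracket x y := by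
  simp only [bracket, Matrix.mulVec, dotProduct, Fin.sum_univ_two, Matrix.det_fin_two]; ring

lemma map_bracket {R S : Type*} [CommRing R] [CommRing S] (f : R →+* S) (x y : Fin 2 → R) :
    f (bracket x y) = bracket (fun i => f (x i)) (fun i => f (y i)) := by
  simp [bracket]

lemma exists_bracket_eq_one {x : Fin 2 → ℂ} (hx : x ≠ 0) : ∃ y, bracket x y = 1 := by
  by_cases h : x 0 = 0
  · have h1 : x 1 ≠ 0 := fun h1 => hx (by ext i; fin_cases i <;> simp [h, h1])
    exact ⟨![-(x 1)⁻¹, 0], by simp [bracket, h1]⟩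
  · exact ⟨![0, (x 0)⁻¹], by simp [bracket, h]⟩

/-- Two vectors of the plane with determinant `1` are a basis: coordinates of `u`. -/
lemma eq_add_of_bracket_eq_one {x y : Fin 2 → ℂ} (h : bracket x y = 1) (u : Fin 2 → ℂ) :
    u = bracket u y • x + bracket x u • y := by
  simp only [bracket] at *
  ext i
  fin_cases i <;> simp <;> linear_combination -(u _) * h

lemma exists_eq_smul_of_bracket_eq_zero {x y : Fin 2 → ℂ} (hx : x ≠ 0) (h : bracket x y = 0) :
    ∃ c : ℂ, y = c • x := by
  obtain ⟨z, hz⟩ := exists_bracket_eq_one hx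
  refine ⟨bracket y z, ?_⟩
  conv_lhs => rw [eq_add_of_bracket_eq_one hz y, h, zero_smul, add_zero]

/-- Binary forms of degree `d`, regarded as functions on `ℂ²`. -/
noncomputable def binaryForms (d : ℕ) : Submodule ℂ ((Fin 2 → ℂ) → ℂ) :=
  (MvPolynomial.homogeneousSubmodule (Fin 2) ℂ d).map
    (LinearMap.pi fun u => (MvPolynomial.aeval u).toLinearMap)

lemma mem_binaryForms {d : ℕ} {f : (Fin 2 → ℂ) → ℂ} :
    f ∈ binaryForms d ↔
      ∃ p : MvPolynomial (Fin 2) ℂ, p.IsHomogeneous d ∧ ∀ u, MvPolynomial.eval u p = f u := by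
  simp [binaryForms, Submodule.mem_map, funext_iff, MvPolynomial.aeval_eq_eval]

lemma eval_mem_binaryForms {d : ℕ} {p : MvPolynomial (Fin 2) ℂ} (hp : p.IsHomogeneous d) :
    (fun u => MvPolynomial.eval u p) ∈ binaryForms d :=
  mem_binaryForms.2 ⟨p, hp, fun _ => rfl⟩

lemma sum_mem_binaryForms {ι : Type*} (s : Finset ι) {d : ℕ} {f : ι → (Fin 2 → ℂ) → ℂ}
    (hf : ∀ i ∈ s, f i ∈ binaryForms d) : (fun u => ∑ i ∈ s, f i u) ∈ binaryForms d := by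
  have := (binaryForms d).sum_mem hf
  convert this using 1
  ext u; simp

lemma const_mul_mem_binaryForms {d : ℕ} (c : ℂ) {f : (Fin 2 → ℂ) → ℂ} (hf : f ∈ binaryForms d) :
    (fun u => c * f u) ∈ binaryForms d :=
  (binaryForms d).smul_mem c hf

lemma mul_mem_binaryForms {d e : ℕ} {f g : (Fin 2 → ℂ) → ℂ} (hf : f ∈ binaryForms d)
    (hg : g ∈ binaryForms e) : (fun u => f u * g u) ∈ binaryForms (d + e) := by
  obtain ⟨p, hp, hpf⟩ := mem_binaryForms.1 hf
  obtain ⟨q, hq, hqg⟩ := mem_binaryForms.1 hg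
  exact mem_binaryForms.2 ⟨p * q, hp.mul hq, fun u => by simp [hpf, hqg]⟩

lemma linear_mem_binaryForms (a b : ℂ) : (fun u : Fin 2 → ℂ => a * u 0 + b * u 1) ∈
    binaryForms 1 := by
  refine mem_binaryForms.2 ⟨MvPolynomial.C a * MvPolynomial.X 0 + MvPolynomial.C b *
    MvPolynomial.X 1, ?_, fun u => by simp⟩
  exact (MvPolynomial.isHomogeneous_C_mul_X a 0).add (MvPolynomial.isHomogeneous_C_mul_X b 1)

lemma bracket_mem_binaryForms (z : Fin 2 → ℂ) : (fun u => bracket u z) ∈ binaryForms 1 := by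
  convert linear_mem_binaryForms (z 1) (-z 0) using 2 with u
  simp only [bracket]; ring

lemma prod_bracket_mem_binaryForms {ι : Type*} (s : Finset ι) (z : ι → Fin 2 → ℂ) :
    (fun u => ∏ i ∈ s, bracket u (z i)) ∈ binaryForms s.card := by
  classical
  induction s using Finset.induction_on with
  | empty => exact mem_binaryForms.2 ⟨1, MvPolynomial.isHomogeneous_one _ _, fun u => by simp⟩
  | insert i s hi ih =>
    simp only [Finset.prod_insert hi, Finset.card_insert_of_notMem hi]
    rw [add_comm]
    exact mul_mem_binaryForms (bracket_mem_binaryForms _) ih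

lemma comp_mulVec_mem_binaryForms {d : ℕ} {f : (Fin 2 → ℂ) → ℂ} (hf : f ∈ binaryForms d)
    (N : Matrix (Fin 2) (Fin 2) ℂ) : (fun u => f (N *ᵥ u)) ∈ binaryForms d := by
  obtain ⟨p, hp, hpf⟩ := mem_binaryForms.1 hf
  refine mem_binaryForms.2 ⟨MvPolynomial.aeval (fun i => MvPolynomial.C (N i 0) *
    MvPolynomial.X 0 + MvPolynomial.C (N i 1) * MvPolynomial.X 1) p, ?_, fun u => ?_⟩
  · have := hp.aeval (S := ℂ) (n := 1) (fun i => MvPolynomial.C (N i 0) *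
      MvPolynomial.X (0 : Fin 2) + MvPolynomial.C (N i 1) * MvPolynomial.X 1) (fun i =>
        (MvPolynomial.isHomogeneous_C_mul_X _ 0).add (MvPolynomial.isHomogeneous_C_mul_X _ 1))
    simpa using this
  · rw [← hpf, ← MvPolynomial.aeval_eq_eval, ← MvPolynomial.aeval_eq_eval]
    change ((MvPolynomial.aeval u).comp (MvPolynomial.aeval _)) p = _
    rw [MvPolynomial.comp_aeval]
    congr 2
    ext i
    simp [Matrix.mulVec, dotProduct, Fin.sum_univ_two]

lemma exponent_add_exponent {d : ℕ} {p : MvPolynomial (Fin 2) ℂ} (hp : p.IsHomogeneous d)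
    {m : Fin 2 →₀ ℕ} (hm : m ∈ p.support) : m 0 + m 1 = d := by
  rw [← Fin.sum_univ_two m, hp.degree_eq_sum_deg_support hm]
  exact (Finset.sum_subset (Finset.subset_univ _) (by simp)).symm

lemma binaryForms_smul {d : ℕ} {f : (Fin 2 → ℂ) → ℂ} (hf : f ∈ binaryForms d) (c : ℂ)
    (u : Fin 2 → ℂ) : f (c • u) = c ^ d * f u := by
  obtain ⟨p, hp, hpf⟩ := mem_binaryForms.1 hf
  rw [← hpf, ← hpf, MvPolynomial.eval_eq', MvPolynomial.eval_eq', Finset.mul_sum]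
  refine Finset.sum_congr rfl fun m hm => ?_
  rw [← exponent_add_exponent hp hm]
  simp only [Fin.prod_univ_two, Pi.smul_apply, smul_eq_mul, mul_pow]
  ring

/-- A binary form of degree `d + 1` is a multiple of `u₀ᵈ⁺¹` modulo `u₁`. -/
lemma exists_eq_pow_add_mul {d : ℕ} {f : (Fin 2 → ℂ) → ℂ} (hf : f ∈ binaryForms (d + 1)) :
    ∃ c : ℂ, ∃ g ∈ binaryForms d, ∀ u, f u = c * u 0 ^ (d + 1) + u 1 * g u := by
  obtain ⟨p, hp, hpf⟩ := mem_binaryForms.1 hf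
  have key : ∀ m : Fin 2 →₀ ℕ, ∃ c : ℂ, ∃ g ∈ binaryForms d, m ∈ p.support → ∀ u,
      p.coeff m * ∏ i, u i ^ m i = c * u 0 ^ (d + 1) + u 1 * g u := by
    intro m
    by_cases hm : m ∈ p.support
    swap
    · exact ⟨0, 0, zero_mem _, fun h => absurd h hm⟩
    have hd := exponent_add_exponent hp hm
    cases h1 : m 1 with
    | zero =>
      refine ⟨p.coeff m, 0, zero_mem _, fun _ u => ?_⟩
      rw [h1, add_zero] at hd
      simp [Fin.prod_univ_two, h1, hd]
    | succ k =>
      rw [h1] at hd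
      have hX : (MvPolynomial.C (p.coeff m) * (MvPolynomial.X (0 : Fin 2) ^ m 0 *
          MvPolynomial.X 1 ^ k)).IsHomogeneous d := by
        have := ((MvPolynomial.isHomogeneous_X_pow (R := ℂ) (0 : Fin 2) (m 0)).mul
          (MvPolynomial.isHomogeneous_X_pow (1 : Fin 2) k)).C_mul (p.coeff m)
        convert this using 1
        omega
      refine ⟨0, _, eval_mem_binaryForms hX, fun _ u => ?_⟩
      simp [Fin.prod_univ_two, h1]
      ring
  choose c g hg h using key
  refine ⟨∑ m ∈ p.support, c m, _, sum_mem_binaryForms p.support fun m _ => hg m, fun u => ?_⟩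
  rw [← hpf, MvPolynomial.eval_eq', Finset.sum_mul, Finset.mul_sum, ← Finset.sum_add_distrib]
  exact Finset.sum_congr rfl fun m hm => h m hm u

lemma exists_eq_const_of_mem_binaryForms_zero {f : (Fin 2 → ℂ) → ℂ} (hf : f ∈ binaryForms 0) :
    ∃ c, ∀ u, f u = c := by
  refine ⟨f 0, fun u => ?_⟩
  have := binaryForms_smul hf 0 u
  simpa using this.symm

lemma exists_eq_linear_of_mem_binaryForms_one {f : (Fin 2 → ℂ) → ℂ} (hf : f ∈ binaryForms 1) :
    ∃ a b, ∀ u, f u = a * u 0 + b * u 1 := by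
  obtain ⟨a, g, hg, h⟩ := exists_eq_pow_add_mul hf
  obtain ⟨b, hb⟩ := exists_eq_const_of_mem_binaryForms_zero hg
  exact ⟨a, b, fun u => by rw [h, hb]; ring⟩

lemma exists_eq_bracket_mul {d : ℕ} {f : (Fin 2 → ℂ) → ℂ} (hf : f ∈ binaryForms (d + 1))
    {z : Fin 2 → ℂ} (hz : z ≠ 0) (hfz : f z = 0) :
    ∃ g ∈ binaryForms d, ∀ u, f u = bracket u z * g u := by
  obtain ⟨y, hy⟩ := exists_bracket_eq_one hz
  -- In the coordinates given by the basis `z, y` the zero is at `(1, 0)`.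
  obtain ⟨c, g, hg, h⟩ := exists_eq_pow_add_mul
    (comp_mulVec_mem_binaryForms hf !![z 0, y 0; z 1, y 1])
  have hc : c = 0 := by
    have h1 := h ![1, 0]
    have : !![z 0, y 0; z 1, y 1] *ᵥ ![1, 0] = z := by
      ext i; fin_cases i <;> simp [Matrix.mulVec, dotProduct, Fin.sum_univ_two]
    rw [this, hfz] at h1
    simpa using h1.symm
  refine ⟨_, const_mul_mem_binaryForms (-1)
    (comp_mulVec_mem_binaryForms hg !![y 1, -y 0; -z 1, z 0]), fun u => ?_⟩
  have h2 := h (!![y 1, -y 0; -z 1, z 0] *ᵥ u)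
  have h3 : !![z 0, y 0; z 1, y 1] *ᵥ !![y 1, -y 0; -z 1, z 0] *ᵥ u = u := by
    simp only [bracket] at hy
    ext i
    fin_cases i <;> simp [Matrix.mulVec, dotProduct, Fin.sum_univ_two]
    · linear_combination u 0 * hy
    · linear_combination u 1 * hy
  rw [h3] at h2
  rw [h2, hc]
  simp [Matrix.mulVec, dotProduct, Fin.sum_univ_two, bracket]
  ring

lemma exists_eq_prod_bracket_mul {ι : Type*} (s : Finset ι) {d : ℕ} {f : (Fin 2 → ℂ) → ℂ}
    (hf : f ∈ binaryForms (s.card + d)) {z : ι → Fin 2 → ℂ} (hz0 : ∀ i ∈ s, z i ≠ 0)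
    (hz : ∀ i ∈ s, ∀ j ∈ s, i ≠ j → bracket (z i) (z j) ≠ 0) (hfz : ∀ i ∈ s, f (z i) = 0) :
    ∃ g ∈ binaryForms d, ∀ u, f u = (∏ i ∈ s, bracket u (z i)) * g u := by
  classical
  induction s using Finset.induction_on generalizing f with
  | empty => exact ⟨f, by simpa using hf, fun u => by simp⟩
  | insert i s hi ih =>
    rw [Finset.card_insert_of_notMem hi, add_right_comm] at hf
    obtain ⟨g, hg, h⟩ := exists_eq_bracket_mul hf (hz0 i (by simp)) (hfz i (by simp))
    obtain ⟨k, hk, h'⟩ := ih hg (fun j hj => hz0 j (by simp [hj]))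
      (fun j hj l hl => hz j (by simp [hj]) l (by simp [hl])) (fun j hj => by
        have h1 := hfz j (by simp [hj])
        rw [h] at h1
        refine (mul_eq_zero.1 h1).resolve_left (hz j (by simp [hj]) i (by simp) ?_)
        rintro rfl
        exact hi hj)
    exact ⟨k, hk, fun u => by rw [h, h', Finset.prod_insert hi]; ring⟩

/-- A binary form of degree `d` with more than `d` zeros on the projective line vanishes. -/
lemma eq_zero_of_card_eq_succ {ι : Type*} (s : Finset ι) {d : ℕ} (hs : s.card = d + 1)
    {f : (Fin 2 → ℂ) → ℂ} (hf : f ∈ binaryForms d) {z : ι → Fin 2 → ℂ} (hz0 : ∀ i ∈ s, z i ≠ 0)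
    (hz : ∀ i ∈ s, ∀ j ∈ s, i ≠ j → bracket (z i) (z j) ≠ 0) (hfz : ∀ i ∈ s, f (z i) = 0)
    (u : Fin 2 → ℂ) : f u = 0 := by
  classical
  obtain ⟨i, t, hi, rfl, ht⟩ := Finset.card_eq_succ.1 hs
  obtain ⟨g, hg, h⟩ := exists_eq_prod_bracket_mul t (d := 0) (by simpa [ht] using hf)
    (fun j hj => hz0 j (by simp [hj]))
    (fun j hj l hl => hz j (by simp [hj]) l (by simp [hl])) (fun j hj => hfz j (by simp [hj]))
  obtain ⟨c, hc⟩ := exists_eq_const_of_mem_binaryForms_zero hg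
  have h1 := hfz i (by simp)
  rw [h, hc] at h1
  have hc0 : c = 0 := (mul_eq_zero.1 h1).resolve_left <| Finset.prod_ne_zero_iff.2 fun j hj =>
    hz i (by simp) j (by simp [hj]) (by rintro rfl; exact hi hj)
  rw [h, hc, hc0, mul_zero]

/-! ### Parametrized curves through points with prescribed parameters -/

/-- The matrix whose columns are the first `n + 1` of the `n + 2` vectors `v`. -/
def frame {R : Type*} {n : ℕ} (v : Fin (n + 2) → Fin (n + 1) → R) :
    Matrix (Fin (n + 1)) (Fin (n + 1)) R :=
  Matrix.of fun k i => v i.castSucc k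

lemma frame_mulVec {R : Type*} [CommRing R] {n : ℕ} (v : Fin (n + 2) → Fin (n + 1) → R)
    (a : Fin (n + 1) → R) : frame v *ᵥ a = ∑ i, a i • v i.castSucc := by
  ext k
  simp [frame, Matrix.mulVec, dotProduct, mul_comm]

/-- `Φ` is a vector of binary forms of degree `n` which takes the parameter `u i` to the point
`[v i]` for every `i`. -/
structure Interpolates {n : ℕ} (v : Fin (n + 2) → Fin (n + 1) → ℂ) (u : Fin (n + 2) → Fin 2 → ℂ)
    (Φ : (Fin 2 → ℂ) → Fin (n + 1) → ℂ) : Prop where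
  mem : ∀ k, (fun x => Φ x k) ∈ binaryForms n
  apply_eq : ∀ i, ∃ c : ℂ, c ≠ 0 ∧ Φ (u i) = c • v i

lemma ne_zero_of_bracket_ne_zero {n : ℕ} {u : Fin (n + 2) → Fin 2 → ℂ}
    (hu : ∀ i j, i ≠ j → bracket (u i) (u j) ≠ 0) (i : Fin (n + 2)) : u i ≠ 0 := by
  intro h
  obtain ⟨j, hj⟩ := exists_ne i
  exact hu i j hj.symm (by rw [h, bracket_zero_left])

section

variable {n : ℕ} {v : Fin (n + 2) → Fin (n + 1) → ℂ} {u : Fin (n + 2) → Fin 2 → ℂ}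
  {Φ Ψ : (Fin 2 → ℂ) → Fin (n + 1) → ℂ}

lemma mulVec_mem_binaryForms {m : ℕ} (hΦ : ∀ k, (fun x => Φ x k) ∈ binaryForms n)
    (A : Matrix (Fin m) (Fin (n + 1)) ℂ) (r : Fin m) :
    (fun x => (A *ᵥ Φ x) r) ∈ binaryForms n :=
  sum_mem_binaryForms Finset.univ fun k _ => const_mul_mem_binaryForms (A r k) (hΦ k)

/-- In the basis `v 0, …, v n` the `i`-th coordinate of an interpolating vector of forms vanishes
at the other `n` parameters, which determines it up to a factor. -/
lemma Interpolates.exists_coord_eq (hv : (frame v).det ≠ 0)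
    (hu : ∀ i j, i ≠ j → bracket (u i) (u j) ≠ 0) (h : Interpolates v u Φ) (i : Fin (n + 1)) :
    ∃ c : ℂ, ∀ x, ((frame v)⁻¹ *ᵥ Φ x) i =
      (∏ j ∈ Finset.univ.erase i, bracket x (u j.castSucc)) * c := by
  obtain ⟨g, hg, hg'⟩ := exists_eq_prod_bracket_mul (Finset.univ.erase i) (d := 0)
    (f := fun x => ((frame v)⁻¹ *ᵥ Φ x) i) (z := fun j => u j.castSucc)
    (by simpa using mulVec_mem_binaryForms h.mem _ i)
    (fun j _ => ne_zero_of_bracket_ne_zero hu _)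
    (fun j _ k _ hjk => hu _ _ (by simpa using hjk)) (fun j hj => by
      obtain ⟨c, -, hc⟩ := h.apply_eq j.castSucc
      have h1 : v j.castSucc = frame v *ᵥ Pi.single j 1 := by
        rw [frame_mulVec]
        simp [Pi.single_apply]
      rw [hc, h1, Matrix.mulVec_smul, Matrix.mulVec_mulVec,
        Matrix.nonsing_inv_mul _ (isUnit_iff_ne_zero.2 hv), Matrix.one_mulVec]
      have : i ≠ j := by simpa [eq_comm] using hj
      simp [this])
  obtain ⟨c, hc⟩ := exists_eq_const_of_mem_binaryForms_zero hg
  exact ⟨c, fun x => by rw [hg', hc]⟩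

/-- A parametrized curve of degree `n` is determined by the images of `n + 2` parameters. -/
lemma Interpolates.exists_eq_smul (hv : (frame v).det ≠ 0)
    (hu : ∀ i j, i ≠ j → bracket (u i) (u j) ≠ 0) (h : Interpolates v u Φ)
    (h' : Interpolates v u Ψ) : ∃ a : ℂ, a ≠ 0 ∧ ∀ x, Φ x = a • Ψ x := by
  choose c hc using h.exists_coord_eq hv hu
  choose d hd using h'.exists_coord_eq hv hu
  obtain ⟨μ, hμ, hΦ⟩ := h.apply_eq (Fin.last _)
  obtain ⟨ν, hν, hΨ⟩ := h'.apply_eq (Fin.last _)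
  have hcd : ∀ i, c i = μ / ν * d i := by
    intro i
    have h1 := hc i (u (Fin.last _))
    have h2 := hd i (u (Fin.last _))
    rw [hΦ, Matrix.mulVec_smul, Pi.smul_apply, smul_eq_mul] at h1
    rw [hΨ, Matrix.mulVec_smul, Pi.smul_apply, smul_eq_mul] at h2
    have h3 : ∏ j ∈ Finset.univ.erase i, bracket (u (Fin.last _)) (u j.castSucc) ≠ 0 :=
      Finset.prod_ne_zero_iff.2 fun j _ => hu _ _ (Fin.castSucc_lt_last j).ne'
    field_simp
    apply mul_left_cancel₀ h3
    linear_combination μ * h2 - ν * h1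
  refine ⟨μ / ν, div_ne_zero hμ hν, fun x => ?_⟩
  have h4 : (frame v)⁻¹ *ᵥ Φ x = (frame v)⁻¹ *ᵥ ((μ / ν) • Ψ x) := by
    ext i
    rw [Matrix.mulVec_smul, Pi.smul_apply, hc, hd, hcd, smul_eq_mul]
    ring
  have h5 := congrArg (fun y => frame v *ᵥ y) h4
  simpa only [Matrix.mulVec_mulVec, Matrix.mul_nonsing_inv _ (isUnit_iff_ne_zero.2 hv),
    Matrix.one_mulVec] using h5

/-- The coordinates of an interpolating vector of forms are a basis of all forms: a form of degree
`n` is determined by its values at the `n + 1` parameters, and there the vector of forms takes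
linearly independent values. -/
lemma Interpolates.exists_basis (hv : (frame v).det ≠ 0)
    (hu : ∀ i j, i ≠ j → bracket (u i) (u j) ≠ 0) (h : Interpolates v u Φ) :
    ∃ F : Module.Basis (Fin (n + 1)) ℂ (MvPolynomial.homogeneousSubmodule (Fin 2) ℂ n),
      ∀ x k, MvPolynomial.eval x (F k : MvPolynomial (Fin 2) ℂ) = Φ x k := by
  choose p hp hpΦ using fun k => mem_binaryForms.1 (h.mem k)
  choose c hc0 hc using h.apply_eq
  let P : Fin (n + 1) → MvPolynomial.homogeneousSubmodule (Fin 2) ℂ n := fun k => ⟨p k, hp k⟩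
  have hP : ∀ (a : Fin (n + 1) → ℂ) (i : Fin (n + 1)),
      MvPolynomial.eval (u i.castSucc) ((∑ k, a k • P k : MvPolynomial.homogeneousSubmodule
        (Fin 2) ℂ n) : MvPolynomial (Fin 2) ℂ) = c i.castSucc * (a ᵥ* frame v) i := by
    intro a i
    simp only [P, Submodule.coe_sum, Submodule.coe_smul, map_sum, MvPolynomial.smul_eval, hpΦ, hc,
      Matrix.vecMul, dotProduct, frame, Matrix.of_apply, Pi.smul_apply, smul_eq_mul,
      Finset.mul_sum]
    exact Finset.sum_congr rfl fun k _ => by ring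
  have hli : LinearIndependent ℂ P := by
    rw [Fintype.linearIndependent_iff]
    intro a ha
    have h1 : a ᵥ* frame v = 0 := by
      ext i
      have := hP a i
      rw [ha] at this
      simpa [hc0] using this.symm
    exact congrFun (Matrix.eq_zero_of_vecMul_eq_zero hv h1)
  have hspan : ⊤ ≤ Submodule.span ℂ (Set.range P) := by
    rintro ⟨q, hq⟩ -
    rw [Submodule.mem_span_range_iff_exists_fun]
    let b : Fin (n + 1) → ℂ := fun i => MvPolynomial.eval (u i.castSucc) q / c i.castSucc
    refine ⟨b ᵥ* (frame v)⁻¹, Subtype.ext (MvPolynomial.funext fun x => ?_)⟩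
    have hform := eval_mem_binaryForms (((∑ k, (b ᵥ* (frame v)⁻¹) k • P k) - ⟨q, hq⟩ :
      MvPolynomial.homogeneousSubmodule (Fin 2) ℂ n).2)
    have h0 := eq_zero_of_card_eq_succ (Finset.univ : Finset (Fin (n + 1))) (by simp) hform
      (z := fun j => u j.castSucc) (fun j _ => ne_zero_of_bracket_ne_zero hu _)
      (fun j _ k _ hjk => hu _ _ (by simpa using hjk)) (fun j _ => by
        rw [Submodule.coe_sub, map_sub, hP, Matrix.vecMul_vecMul,
          Matrix.nonsing_inv_mul _ (isUnit_iff_ne_zero.2 hv), Matrix.vecMul_one]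
        simp only [b]
        field_simp [hc0]
        simp) x
    rw [Submodule.coe_sub, map_sub] at h0
    exact sub_eq_zero.1 h0
  refine ⟨Module.Basis.mk hli hspan, fun x k => ?_⟩
  rw [Module.Basis.mk_apply]
  exact hpΦ k x

end

/-- A rational normal curve separates the points of the projective line. With `c = 0`, this also
says that its parametrization has no zero. -/
lemma bracket_eq_zero_of_eval_eq {n : ℕ} (hn : n ≠ 0)
    (F : Module.Basis (Fin (n + 1)) ℂ (MvPolynomial.homogeneousSubmodule (Fin 2) ℂ n))
    {x y : Fin 2 → ℂ} (c : ℂ)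
    (h : ∀ k, MvPolynomial.eval x (F k : MvPolynomial (Fin 2) ℂ) =
      c * MvPolynomial.eval y (F k : MvPolynomial (Fin 2) ℂ)) : bracket x y = 0 := by
  -- The form `[·, y]ⁿ` vanishes at `y` and is a combination of the members of the basis.
  obtain ⟨p, hp, hpy⟩ := mem_binaryForms.1
    (prod_bracket_mem_binaryForms (Finset.univ : Finset (Fin n)) fun _ => y)
  simp only [Finset.card_univ, Fintype.card_fin, Finset.prod_const] at hp hpy
  have hsum := congrArg (Submodule.subtype _) (F.sum_repr ⟨p, hp⟩)
  simp only [map_sum, map_smul, Submodule.subtype_apply] at hsum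
  have hxy : MvPolynomial.eval x p = c * MvPolynomial.eval y p := by
    rw [← hsum]
    simp only [map_sum, MvPolynomial.smul_eval, h, Finset.mul_sum]
    exact Finset.sum_congr rfl fun k _ => by ring
  rw [hpy, hpy, bracket_self, zero_pow hn, mul_zero] at hxy
  exact pow_eq_zero_iff hn |>.1 hxy

lemma eval_basis_ne_zero {n : ℕ} (hn : n ≠ 0)
    (F : Module.Basis (Fin (n + 1)) ℂ (MvPolynomial.homogeneousSubmodule (Fin 2) ℂ n))
    {x : Fin 2 → ℂ} (hx : x ≠ 0) :
    (fun k => MvPolynomial.eval x (F k : MvPolynomial (Fin 2) ℂ)) ≠ 0 := by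
  intro h
  obtain ⟨y, hy⟩ := exists_bracket_eq_one hx
  have := bracket_eq_zero_of_eval_eq hn F (x := x) (y := y) 0 fun k => by
    simpa using congrFun h k
  simp [this] at hy

/-- Proportional parametrizations that differ by a projectivity of the line have the same image. -/
lemma imageOfLine_eq_of_mulVec {n : ℕ} {F G : Fin (n + 1) → MvPolynomial (Fin 2) ℂ}
    {N : Matrix (Fin 2) (Fin 2) ℂ} (hN : N.det ≠ 0) {a : ℂ} (ha : a ≠ 0)
    (h : ∀ x, (fun k => MvPolynomial.eval (N *ᵥ x) (F k)) =
      a • fun k => MvPolynomial.eval x (G k)) : imageOfLine F = imageOfLine G := by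
  have hNu := isUnit_iff_ne_zero.2 hN
  ext P
  constructor
  · rintro ⟨x, hx, hF, rfl⟩
    have hxN : N *ᵥ N⁻¹ *ᵥ x = x := by
      rw [Matrix.mulVec_mulVec, Matrix.mul_nonsing_inv _ hNu, Matrix.one_mulVec]
    have h1 := h (N⁻¹ *ᵥ x)
    rw [hxN] at h1
    refine ⟨N⁻¹ *ᵥ x, fun h0 => hx (by rw [← hxN, h0, Matrix.mulVec_zero]), fun h0 => hF ?_, ?_⟩
    · rw [h1, h0, smul_zero]
    · rw [Projectivization.mk_eq_mk_iff']
      exact ⟨a, h1.symm⟩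
  · rintro ⟨x, hx, hG, rfl⟩
    have h1 := h x
    refine ⟨N *ᵥ x, fun h0 => hx (Matrix.eq_zero_of_mulVec_eq_zero hN h0), ?_, ?_⟩
    · rw [h1]
      exact smul_ne_zero ha hG
    · rw [Projectivization.mk_eq_mk_iff']
      exact ⟨a⁻¹, by rw [h1, smul_smul, inv_mul_cancel₀ ha, one_smul]⟩

/-- Distinct points of the image of the line have distinct parameters. -/
lemma exists_parameters {n k : ℕ} {F : Fin (n + 1) → MvPolynomial (Fin 2) ℂ}
    (hF : ∀ i, (F i).IsHomogeneous n) {S : Set (PSpace n)} (hS : S ⊆ imageOfLine F)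
    (hk : (k : ℕ∞) ≤ S.encard) :
    ∃ z : Fin k → Fin 2 → ℂ, (∀ i, z i ≠ 0) ∧ (∀ i j, i ≠ j → bracket (z i) (z j) ≠ 0) ∧
      ∀ i, ∃ h : (fun j => MvPolynomial.eval (z i) (F j)) ≠ 0,
        Projectivization.mk ℂ _ h ∈ S := by
  obtain ⟨T, hTS, hT⟩ := Set.exists_subset_encard_eq hk
  have hTfin : T.Finite := Set.finite_of_encard_eq_coe hT
  have hcard : Nat.card T = k := by
    rw [Nat.card_coe_set_eq, Set.ncard, hT, ENat.toNat_natCast]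
  have : Finite T := hTfin
  let e : Fin k ≃ T := (Finite.equivFinOfCardEq hcard).symm
  choose z hz0 hz hzP using fun i => hS (hTS (e i).2)
  refine ⟨z, hz0, fun i j hij hb => hij ?_, fun i => ⟨hz i, hzP i ▸ hTS (e i).2⟩⟩
  obtain ⟨c, hc⟩ := exists_eq_smul_of_bracket_eq_zero (hz0 i) hb
  apply e.injective
  apply Subtype.ext
  rw [hzP i, hzP j, eq_comm, Projectivization.mk_eq_mk_iff']
  refine ⟨c ^ n, ?_⟩
  ext l
  rw [hc]
  exact (binaryForms_smul (eval_mem_binaryForms (hF l)) c (z i)).symm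

/-! ### The explicit curve -/

section

variable {R S : Type*} [CommRing R] [CommRing S] {n : ℕ}

/-- The coordinates of the last vector of `v` in the basis formed by the others, times the
determinant of this basis. -/
def weight (v : Fin (n + 2) → Fin (n + 1) → R) (i : Fin (n + 1)) : R :=
  (frame v).cramer (v (Fin.last _)) i

lemma sum_weight_smul (v : Fin (n + 2) → Fin (n + 1) → R) :
    ∑ i, weight v i • v i.castSucc = (frame v).det • v (Fin.last _) := by
  rw [← Matrix.mulVec_cramer, frame_mulVec]
  rfl

/-- The parametrized curve of degree `n` which takes the parameter `u i` to `[v i]`. -/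
def curve (v : Fin (n + 2) → Fin (n + 1) → R) (u : Fin (n + 2) → Fin 2 → R) (x : Fin 2 → R) :
    Fin (n + 1) → R :=
  ∑ i, (weight v i * bracket (u (Fin.last _)) (u i.castSucc) *
    ∏ j ∈ Finset.univ.erase i, bracket x (u j.castSucc)) • v i.castSucc

lemma prod_bracket_erase_mul (u : Fin (n + 2) → Fin 2 → R) (x : Fin 2 → R) (i : Fin (n + 1)) :
    (∏ j ∈ Finset.univ.erase i, bracket x (u j.castSucc)) * bracket x (u i.castSucc) =
      ∏ j : Fin (n + 1), bracket x (u j.castSucc) :=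
  Finset.prod_erase_mul _ _ (Finset.mem_univ i)

/-- If the parameters are the images `A v i` of the points under the projection `A` to the line,
then `A` inverts the parametrization. -/
lemma bracket_mulVec_curve (A : Matrix (Fin 2) (Fin (n + 1)) R)
    (v : Fin (n + 2) → Fin (n + 1) → R) (x : Fin 2 → R) :
    bracket x (A *ᵥ curve v (fun i => A *ᵥ v i) x) = 0 := by
  set u : Fin (n + 2) → Fin 2 → R := fun i => A *ᵥ v i with hu
  have h1 : A *ᵥ curve v u x = ∑ i, (weight v i * bracket (u (Fin.last _)) (u i.castSucc) *
      ∏ j ∈ Finset.univ.erase i, bracket x (u j.castSucc)) • u i.castSucc := by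
    simp only [curve, Matrix.mulVec_sum, Matrix.mulVec_smul, hu]
  have h2 : ∑ i, weight v i • u i.castSucc = (frame v).det • u (Fin.last _) := by
    simp only [hu, ← Matrix.mulVec_smul, ← sum_weight_smul, Matrix.mulVec_sum]
  have h3 := congrArg (bracket (u (Fin.last _))) h2
  rw [bracket_smul_right, bracket_self, mul_zero, bracket_sum_right] at h3
  rw [h1, bracket_sum_right]
  rw [← mul_zero (∏ j : Fin (n + 1), bracket x (u j.castSucc)), ← h3, Finset.mul_sum]
  refine Finset.sum_congr rfl fun i _ => ?_
  rw [bracket_smul_right, bracket_smul_right, ← prod_bracket_erase_mul u x i]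
  ring

/-- On the affine line, the form of degree `n` whose zeros are the parameter of the point `v 0` and
the parameters of the points of the curve with `A = 0`. -/
noncomputable def contact (A : Matrix (Fin 2) (Fin (n + 1)) R)
    (v : Fin (n + 2) → Fin (n + 1) → R) : Polynomial R :=
  ∑ i : Fin (n + 1), Polynomial.C (weight v i *
      bracket (A *ᵥ v (Fin.last _)) (A *ᵥ v i.castSucc) * bracket (A *ᵥ v i.castSucc) (A *ᵥ v 0)) *
    ∏ j ∈ Finset.univ.erase i,
      (Polynomial.C ((A *ᵥ v j.castSucc) 1) - Polynomial.X * Polynomial.C ((A *ᵥ v j.castSucc) 0))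

lemma eval_contact (A : Matrix (Fin 2) (Fin (n + 1)) R) (v : Fin (n + 2) → Fin (n + 1) → R)
    (t : R) : (contact A v).eval t =
      bracket (A *ᵥ curve v (fun i => A *ᵥ v i) ![1, t]) (A *ᵥ v 0) := by
  simp only [contact, curve, Matrix.mulVec_sum, Matrix.mulVec_smul, bracket_sum_left,
    bracket_smul_left, Polynomial.eval_finsetSum, Polynomial.eval_mul, Polynomial.eval_prod,
    Polynomial.eval_sub, Polynomial.eval_C, Polynomial.eval_X]
  refine Finset.sum_congr rfl fun i _ => ?_
  simp only [bracket, Matrix.cons_val_zero, Matrix.cons_val_one, one_mul]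
  ring

lemma natDegree_contact_le (A : Matrix (Fin 2) (Fin (n + 1)) R)
    (v : Fin (n + 2) → Fin (n + 1) → R) : (contact A v).natDegree ≤ n := by
  refine Polynomial.natDegree_sum_le_of_forall_le _ _ fun i _ => ?_
  refine (Polynomial.natDegree_C_mul_le _ _).trans ((Polynomial.natDegree_prod_le _ _).trans ?_)
  refine (Finset.sum_le_card_nsmul _ _ 1 fun j _ => ?_).trans (by simp)
  compute_degree

/-- The polynomial in the coordinates whose nonvanishing makes the explicit curve the only solution:
the first points form a basis, no coordinate of the last one vanishes, the projections of all points
to the line are distinct, and `contact` has `n` distinct zeros. -/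
noncomputable def obstruction (A : Matrix (Fin 2) (Fin (n + 1)) R)
    (v : Fin (n + 2) → Fin (n + 1) → R) : R :=
  (frame v).det * (∏ i, weight v i) *
    (∏ i, ∏ j ∈ Finset.univ.erase i, bracket (A *ᵥ v i) (A *ᵥ v j)) * (contact A v).coeff n *
    Polynomial.resultant (contact A v) (Polynomial.derivative (contact A v)) n (n - 1)

lemma map_frame (f : R →+* S) (v : Fin (n + 2) → Fin (n + 1) → R) :
    (frame v).map f = frame fun i k => f (v i k) := rfl

lemma map_weight (f : R →+* S) (v : Fin (n + 2) → Fin (n + 1) → R) (i : Fin (n + 1)) :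
    f (weight v i) = weight (fun i k => f (v i k)) i := by
  simp only [weight, Matrix.cramer_apply, RingHom.map_det, RingHom.mapMatrix_apply,
    Matrix.map_updateCol, map_frame]
  rfl

lemma map_bracket_mulVec (f : R →+* S) (A : Matrix (Fin 2) (Fin (n + 1)) R)
    (x y : Fin (n + 1) → R) : f (bracket (A *ᵥ x) (A *ᵥ y)) =
      bracket (A.map f *ᵥ fun k => f (x k)) (A.map f *ᵥ fun k => f (y k)) := by
  rw [map_bracket]
  simp only [RingHom.map_mulVec]
  rfl

lemma map_contact (f : R →+* S) (A : Matrix (Fin 2) (Fin (n + 1)) R)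
    (v : Fin (n + 2) → Fin (n + 1) → R) :
    (contact A v).map f = contact (A.map f) fun i k => f (v i k) := by
  simp only [contact, Polynomial.map_sum, Polynomial.map_mul, Polynomial.map_C,
    Polynomial.map_prod, Polynomial.map_sub, Polynomial.map_X, map_mul f, map_bracket_mulVec f,
    map_weight f, RingHom.map_mulVec f]
  rfl

lemma map_obstruction (f : R →+* S) (A : Matrix (Fin 2) (Fin (n + 1)) R)
    (v : Fin (n + 2) → Fin (n + 1) → R) :
    f (obstruction A v) = obstruction (A.map f) fun i k => f (v i k) := by
  simp only [obstruction, map_mul, map_prod, map_bracket_mulVec, map_weight, RingHom.map_det,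
    RingHom.mapMatrix_apply, map_frame, ← Polynomial.resultant_map_map,
    ← Polynomial.coeff_map, map_contact]
  rw [← Polynomial.derivative_map, map_contact]

end

/-! ### Existence and uniqueness for given coordinates -/

section

variable {n : ℕ} {A : Matrix (Fin 2) (Fin (n + 1)) ℂ} {v : Fin (n + 2) → Fin (n + 1) → ℂ}

lemma curve_interpolates {u : Fin (n + 2) → Fin 2 → ℂ} (hv : (frame v).det ≠ 0)
    (hw : ∀ i, weight v i ≠ 0) (hu : ∀ i j, i ≠ j → bracket (u i) (u j) ≠ 0) :
    Interpolates v u (curve v u) where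
  mem k := by
    have : (fun x => curve v u x k) = fun x => ∑ i : Fin (n + 1),
        (weight v i * bracket (u (Fin.last _)) (u i.castSucc) * v i.castSucc k) *
          ∏ j ∈ Finset.univ.erase i, bracket x (u j.castSucc) := by
      ext x
      simp only [curve, Finset.sum_apply, Pi.smul_apply, smul_eq_mul]
      exact Finset.sum_congr rfl fun i _ => by ring
    rw [this]
    refine sum_mem_binaryForms _ fun i _ => const_mul_mem_binaryForms _ ?_
    simpa using prod_bracket_mem_binaryForms (Finset.univ.erase i) fun j => u j.castSucc
  apply_eq i := by
    cases i using Fin.lastCases with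
    | last =>
      refine ⟨(∏ j : Fin (n + 1), bracket (u (Fin.last _)) (u j.castSucc)) * (frame v).det,
        mul_ne_zero (Finset.prod_ne_zero_iff.2 fun j _ => hu _ _ (Fin.castSucc_lt_last j).ne') hv,
        ?_⟩
      rw [mul_smul, ← sum_weight_smul, Finset.smul_sum, curve]
      refine Finset.sum_congr rfl fun i _ => ?_
      rw [smul_smul, ← prod_bracket_erase_mul _ _ i]
      congr 1
      ring
    | cast i =>
      refine ⟨weight v i * bracket (u (Fin.last _)) (u i.castSucc) *
        ∏ j ∈ Finset.univ.erase i, bracket (u i.castSucc) (u j.castSucc),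
        mul_ne_zero (mul_ne_zero (hw i) (hu _ _ (Fin.castSucc_lt_last i).ne'))
          (Finset.prod_ne_zero_iff.2 fun j hj => hu _ _ (by simpa [eq_comm] using hj)), ?_⟩
      rw [curve]
      refine Finset.sum_eq_single i (fun j _ hj => ?_) (by simp)
      rw [Finset.prod_eq_zero (i := i) (by simpa using hj.symm) (bracket_self _), mul_zero,
        zero_smul]

lemma mk_mem_pointsOf_ker {x : Fin (n + 1) → ℂ} (hx : x ≠ 0) :
    Projectivization.mk ℂ x hx ∈ pointsOf (LinearMap.ker A.mulVecLin) ↔ A *ᵥ x = 0 := by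
  simp [pointsOf, Projectivization.submodule_mk, Submodule.span_singleton_le_iff_mem]

/-- A polynomial with nonzero formal discriminant has as many zeros as its formal degree. -/
lemma card_roots_of_resultant_ne_zero {H : Polynomial ℂ} (hn : n ≠ 0) (hd : H.natDegree ≤ n)
    (hc : H.coeff n ≠ 0)
    (hr : Polynomial.resultant H (Polynomial.derivative H) n (n - 1) ≠ 0) :
    H.roots.toFinset.card = n := by
  have hdeg : H.natDegree = n := le_antisymm hd (Polynomial.le_natDegree_of_ne_zero hc)
  obtain ⟨p, q, -, -, hpq⟩ := Polynomial.exists_mul_add_mul_eq_C_resultant (m := n) (n := n - 1)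
    H (Polynomial.derivative H) hd
    ((Polynomial.natDegree_derivative_le H).trans (Nat.sub_le_sub_right hd 1)) (Or.inl hn)
  have hsep : H.Separable := by
    set r := Polynomial.resultant H (Polynomial.derivative H) n (n - 1)
    refine ⟨Polynomial.C r⁻¹ * p, Polynomial.C r⁻¹ * q, ?_⟩
    calc _ = Polynomial.C r⁻¹ * (H * p + Polynomial.derivative H * q) := by ring
      _ = 1 := by rw [hpq, ← Polynomial.C_mul, inv_mul_cancel₀ hr, Polynomial.C_1]
  rw [Multiset.toFinset_card_of_nodup (Polynomial.nodup_roots hsep),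
    Polynomial.splits_iff_card_roots.1 (IsAlgClosed.splits H), hdeg]

/-- The curve meets `A = 0` in at most `n - 1` points. Otherwise the form `[A ∘ Φ, A (v 0)]` would
vanish at these and at the parameter of `v 0`, hence everywhere, in particular at the parameter of
`v 1`. -/
lemma encard_secant_le {Φ : Fin (n + 1) → MvPolynomial (Fin 2) ℂ}
    (hA : ∀ i j, i ≠ j → bracket (A *ᵥ v i) (A *ᵥ v j) ≠ 0)
    (hΦ : ∀ k, (Φ k).IsHomogeneous n)
    (hI : Interpolates v (fun i => A *ᵥ v i) fun x k => MvPolynomial.eval x (Φ k)) :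
    (pointsOf (LinearMap.ker A.mulVecLin) ∩ imageOfLine Φ).encard ≤ (n - 1 : ℕ) := by
  by_contra! hlt
  have hle : (n : ℕ∞) ≤ (pointsOf (LinearMap.ker A.mulVecLin) ∩ imageOfLine Φ).encard := by
    rcases n with _ | m
    · simp
    · simpa using Order.add_one_le_of_lt hlt
  obtain ⟨z, hz0, hz, hzS⟩ := exists_parameters hΦ Set.inter_subset_right hle
  have hAz : ∀ i, A *ᵥ (fun k => MvPolynomial.eval (z i) (Φ k)) = 0 := fun i => by
    obtain ⟨h, hS⟩ := hzS i
    exact (mk_mem_pointsOf_ker h).1 hS.1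
  obtain ⟨c, hc, hc'⟩ := hI.apply_eq 0
  obtain ⟨d, hd, hd'⟩ := hI.apply_eq 1
  have hu0 := ne_zero_of_bracket_ne_zero hA
  -- The parameter of the point `v 0` is not a zero of `A ∘ Φ`.
  have hb : ∀ i, bracket (A *ᵥ v 0) (z i) ≠ 0 := by
    intro i h
    obtain ⟨e, he⟩ := exists_eq_smul_of_bracket_eq_zero (hu0 0) h
    have h1 := hAz i
    have h2 : (fun k => MvPolynomial.eval (z i) (Φ k)) = (e ^ n * c) • v 0 := by
      ext k
      rw [he, binaryForms_smul (hI.mem k) e, congrFun hc' k]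
      simp [mul_assoc]
    rw [h2, Matrix.mulVec_smul] at h1
    have he0 : e ≠ 0 := by
      rintro rfl
      exact hz0 i (by rw [he, zero_smul])
    exact smul_ne_zero (mul_ne_zero (pow_ne_zero _ he0) hc) (hu0 0) h1
  have hmem : (fun x => bracket (A *ᵥ fun k => MvPolynomial.eval x (Φ k)) (A *ᵥ v 0)) ∈
      binaryForms n := by
    have h0 := mulVec_mem_binaryForms hI.mem A
    have := (binaryForms n).sub_mem (const_mul_mem_binaryForms ((A *ᵥ v 0) 1) (h0 0))
      (const_mul_mem_binaryForms ((A *ᵥ v 0) 0) (h0 1))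
    convert this using 1
    ext x
    simp only [bracket, Pi.sub_apply]
    ring
  have h1 := eq_zero_of_card_eq_succ (Finset.univ : Finset (Option (Fin n))) (by simp) hmem
    (z := fun o => o.elim (A *ᵥ v 0) z)
    (by rintro (_ | i) -; exacts [hu0 0, hz0 i])
    (by
      rintro (_ | i) - (_ | j) - hij
      · exact absurd rfl hij
      · exact hb j
      · rw [bracket_swap]
        exact neg_ne_zero.2 (hb i)
      · exact hz i j fun h => hij (by rw [h]))
    (by
      rintro (_ | i) -
      · change bracket (A *ᵥ fun k => MvPolynomial.eval (A *ᵥ v 0) (Φ k)) _ = 0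
        rw [hc', Matrix.mulVec_smul, bracket_smul_left, bracket_self, mul_zero]
      · change bracket (A *ᵥ fun k => MvPolynomial.eval (z i) (Φ k)) _ = 0
        rw [hAz, bracket_zero_left])
    (A *ᵥ v 1)
  change bracket (A *ᵥ fun k => MvPolynomial.eval (A *ᵥ v 1) (Φ k)) _ = 0 at h1
  rw [hd', Matrix.mulVec_smul, bracket_smul_left] at h1
  exact mul_ne_zero hd (hA 1 0 (by simp)) h1

/-- A solution, reparametrized so that the projection `A` becomes the identity of the line,
interpolates the given points. -/
lemma exists_reparametrization {Φ : Fin (n + 1) → MvPolynomial (Fin 2) ℂ} (hn : n ≠ 0)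
    (hA : ∀ i j, i ≠ j → bracket (A *ᵥ v i) (A *ᵥ v j) ≠ 0)
    (hΦ : ∀ k, (Φ k).IsHomogeneous n)
    (hpt : ∀ i, ∃ h : v i ≠ 0, Projectivization.mk ℂ (v i) h ∈ imageOfLine Φ)
    (hsec : IsSecant (n - 1) (LinearMap.ker A.mulVecLin) (imageOfLine Φ)) :
    ∃ N : Matrix (Fin 2) (Fin 2) ℂ, N.det ≠ 0 ∧
      Interpolates v (fun i => A *ᵥ v i) fun x k => MvPolynomial.eval (N *ᵥ x) (Φ k) := by
  obtain ⟨z, hz0, hz, hzS⟩ := exists_parameters hΦ Set.inter_subset_right hsec.ge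
  have hform : ∀ r, (fun x => (A *ᵥ fun k => MvPolynomial.eval x (Φ k)) r) ∈ binaryForms n :=
    mulVec_mem_binaryForms (fun k => eval_mem_binaryForms (hΦ k)) A
  -- `A ∘ Φ` is a form of degree `n - 1` times a linear map `M`.
  have hfac : ∀ r, ∃ a b : ℂ, ∀ x, (A *ᵥ fun k => MvPolynomial.eval x (Φ k)) r =
      (∏ i, bracket x (z i)) * (a * x 0 + b * x 1) := by
    intro r
    obtain ⟨g, hg, hg'⟩ := exists_eq_prod_bracket_mul (Finset.univ : Finset (Fin (n - 1))) (d := 1)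
      (by simpa [Nat.sub_add_cancel (Nat.one_le_iff_ne_zero.2 hn)] using hform r)
      (fun i _ => hz0 i) (fun i _ j _ => hz i j) (fun i _ => by
        obtain ⟨h, hS⟩ := hzS i
        exact congrFun ((mk_mem_pointsOf_ker h).1 hS.1) r)
    obtain ⟨a, b, hab⟩ := exists_eq_linear_of_mem_binaryForms_one hg
    exact ⟨a, b, fun x => by rw [hg', hab]⟩
  choose a b hab using hfac
  let M : Matrix (Fin 2) (Fin 2) ℂ := Matrix.of fun r => ![a r, b r]
  have hM : ∀ x, A *ᵥ (fun k => MvPolynomial.eval x (Φ k)) =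
      (∏ i, bracket x (z i)) • M *ᵥ x := by
    intro x
    ext r
    rw [hab, Pi.smul_apply, smul_eq_mul]
    congr 1
    simp only [M, Matrix.mulVec, dotProduct, Fin.sum_univ_two, Matrix.of_apply,
      Matrix.cons_val_zero, Matrix.cons_val_one]
  have hu0 := ne_zero_of_bracket_ne_zero hA
  have hy : ∀ i, ∃ y : Fin 2 → ℂ, ∃ c d : ℂ, c ≠ 0 ∧ d ≠ 0 ∧
      (fun k => MvPolynomial.eval y (Φ k)) = c • v i ∧ M *ᵥ y = d • (A *ᵥ v i) := by
    intro i
    obtain ⟨h, y, hy0, hy, hmk⟩ := hpt i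
    rw [eq_comm, Projectivization.mk_eq_mk_iff'] at hmk
    obtain ⟨c, hc⟩ := hmk
    have hc0 : c ≠ 0 := by
      rintro rfl
      exact hy (by rw [← hc, zero_smul])
    have h1 := hM y
    rw [← hc, Matrix.mulVec_smul] at h1
    have hp : ∏ j, bracket y (z j) ≠ 0 := fun h0 => by
      rw [h0, zero_smul] at h1
      exact smul_ne_zero hc0 (hu0 i) h1
    refine ⟨y, c, (∏ j, bracket y (z j))⁻¹ * c, hc0, mul_ne_zero (inv_ne_zero hp) hc0, hc.symm, ?_⟩
    rw [mul_smul, h1, smul_smul, inv_mul_cancel₀ hp, one_smul]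
  choose y c d hc hd hyΦ hyM using hy
  have hdet : M.det ≠ 0 := by
    intro h0
    have h1 := bracket_mulVec M (y 0) (y 1)
    rw [hyM, hyM, h0, zero_mul, bracket_smul_left, bracket_smul_right] at h1
    exact mul_ne_zero (hd 0) (mul_ne_zero (hd 1) (hA 0 1 (by simp))) h1
  have hMu := isUnit_iff_ne_zero.2 hdet
  refine ⟨M⁻¹, (M.isUnit_nonsing_inv_det hMu).ne_zero, fun k => ?_, fun i => ?_⟩
  · exact comp_mulVec_mem_binaryForms (eval_mem_binaryForms (hΦ k)) _
  · refine ⟨(d i)⁻¹ ^ n * c i, mul_ne_zero (pow_ne_zero _ (inv_ne_zero (hd i))) (hc i), ?_⟩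
    have h1 : M⁻¹ *ᵥ (A *ᵥ v i) = (d i)⁻¹ • y i := by
      have h2 : A *ᵥ v i = (d i)⁻¹ • M *ᵥ y i := by
        rw [hyM, smul_smul, inv_mul_cancel₀ (hd i), one_smul]
      rw [h2, Matrix.mulVec_smul, Matrix.mulVec_mulVec, Matrix.nonsing_inv_mul _ hMu,
        Matrix.one_mulVec]
    ext k
    rw [h1, binaryForms_smul (eval_mem_binaryForms (hΦ k)), congrFun (hyΦ i) k]
    simp [mul_assoc]

theorem existsUnique_of_obstruction_ne_zero (hn : 2 ≤ n) (h : obstruction A v ≠ 0)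
    {P : Fin (n + 2) → PSpace n} (hP : ∀ i, ∃ h : v i ≠ 0, P i = Projectivization.mk ℂ (v i) h) :
    ∃! C : Set (PSpace n), IsRationalNormalCurve C ∧ (∀ i, P i ∈ C) ∧
      IsSecant (n - 1) (LinearMap.ker A.mulVecLin) C := by
  have hn0 : n ≠ 0 := by omega
  simp only [obstruction, mul_ne_zero_iff, Finset.prod_ne_zero_iff, Finset.mem_univ,
    true_imp_iff, Finset.mem_erase, and_true] at h
  obtain ⟨⟨⟨⟨hv, hw⟩, hA⟩, hcoeff⟩, hres⟩ := h
  replace hA : ∀ i j, i ≠ j → bracket (A *ᵥ v i) (A *ᵥ v j) ≠ 0 := fun i j hij => hA i j hij.symm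
  have hI := curve_interpolates hv hw hA
  obtain ⟨F, hF⟩ := hI.exists_basis hv hA
  have hF' : ∀ x, (fun k => MvPolynomial.eval x (F k : MvPolynomial (Fin 2) ℂ)) =
      curve v (fun i => A *ᵥ v i) x := fun x => funext (hF x)
  have hFI : Interpolates v (fun i => A *ᵥ v i)
      fun x k => MvPolynomial.eval x (F k : MvPolynomial (Fin 2) ℂ) := by
    simpa only [hF] using hI
  have hu0 := ne_zero_of_bracket_ne_zero hA
  refine ⟨imageOfLine fun k => (F k : MvPolynomial (Fin 2) ℂ), ⟨⟨F, rfl⟩, fun i => ?_, ?_⟩, ?_⟩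
  · obtain ⟨hvi, hPi⟩ := hP i
    obtain ⟨c, hc, hci⟩ := hFI.apply_eq i
    refine ⟨A *ᵥ v i, hu0 i, eval_basis_ne_zero hn0 F (hu0 i), ?_⟩
    rw [hPi, eq_comm, Projectivization.mk_eq_mk_iff']
    exact ⟨c, hci.symm⟩
  · refine le_antisymm (encard_secant_le hA (fun k => (F k).2) hFI) ?_
    -- The zeros of `contact`, apart from the parameter of `v 0`, give `n - 1` points.
    let T := (contact A v).roots.toFinset.erase ((A *ᵥ v 0) 1 / (A *ᵥ v 0) 0)
    have hT : n - 1 ≤ T.card := by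
      rw [← card_roots_of_resultant_ne_zero hn0 (natDegree_contact_le A v) hcoeff hres]
      exact Finset.pred_card_le_card_erase
    have ht0 : ∀ t : ℂ, (![1, t] : Fin 2 → ℂ) ≠ 0 := fun t h0 => by
      simpa using congrFun h0 0
    let f : T → PSpace n := fun t => Projectivization.mk ℂ _ (eval_basis_ne_zero hn0 F (ht0 t))
    have hf : Function.Injective f := by
      intro s t hst
      obtain ⟨c, hc⟩ := (Projectivization.mk_eq_mk_iff' ..).1 hst
      have := bracket_eq_zero_of_eval_eq hn0 F (x := ![1, (s : ℂ)]) (y := ![1, (t : ℂ)]) c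
        fun k => (congrFun hc k).symm
      simp only [bracket, Matrix.cons_val_zero, Matrix.cons_val_one, one_mul, mul_one] at this
      exact Subtype.ext (sub_eq_zero.1 this).symm
    have hsub : Set.range f ⊆ pointsOf (LinearMap.ker A.mulVecLin) ∩
        imageOfLine fun k => (F k : MvPolynomial (Fin 2) ℂ) := by
      rintro _ ⟨⟨t, ht⟩, rfl⟩
      refine ⟨(mk_mem_pointsOf_ker _).2 ?_, ![1, t], ht0 t, _, rfl⟩
      simp only [T, Finset.mem_erase, Multiset.mem_toFinset] at ht
      have h1 := Polynomial.isRoot_of_mem_roots ht.2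
      rw [Polynomial.IsRoot, eval_contact] at h1
      have h2 := bracket_mulVec_curve A v ![1, t]
      change A *ᵥ (fun k => MvPolynomial.eval ![1, t] (F k : MvPolynomial (Fin 2) ℂ)) = 0
      rw [hF']
      by_contra h3
      obtain ⟨e, he⟩ := exists_eq_smul_of_bracket_eq_zero h3 (by rw [bracket_swap, h2, neg_zero] :
        bracket (A *ᵥ curve v (fun i => A *ᵥ v i) ![1, t]) ![1, t] = 0)
      obtain ⟨e', he'⟩ := exists_eq_smul_of_bracket_eq_zero h3 h1
      have he0 : e ≠ 0 := by
        rintro rfl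
        exact ht0 t (by rw [he, zero_smul])
      have h4 : A *ᵥ v 0 = (e' / e) • ![1, t] := by
        rw [he, smul_smul, div_mul_cancel₀ _ he0, ← he']
      have h5 : e' / e ≠ 0 := fun h0 => hu0 0 (by rw [h4, h0, zero_smul])
      apply ht.1
      rw [h4]
      simp only [Pi.smul_apply, Matrix.cons_val_zero, Matrix.cons_val_one, smul_eq_mul, mul_one]
      rw [mul_div_cancel_left₀ _ h5]
    calc ((n - 1 : ℕ) : ℕ∞) ≤ T.card := by exact_mod_cast hT
      _ = (Set.range f).encard := by
        rw [← Set.image_univ, hf.encard_image, Set.encard_univ]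
        simp
      _ ≤ _ := Set.encard_le_encard hsub
  · rintro C ⟨⟨Φ, rfl⟩, hC, hsec⟩
    obtain ⟨N, hN, hΦI⟩ := exists_reparametrization hn0 hA (fun k => (Φ k).2)
      (fun i => by obtain ⟨hvi, hPi⟩ := hP i; exact ⟨hvi, hPi ▸ hC i⟩) hsec
    obtain ⟨a, ha, hΦF⟩ := hΦI.exists_eq_smul hv hA hFI
    exact imageOfLine_eq_of_mulVec hN ha hΦF

end

/-! ### Open sets of data -/

lemma Datum.HasCoords.mulVec_surjective {n p : ℕ} {δ : Datum n p}
    {A : Matrix (Fin 2) (Fin (n + 1)) ℂ} {v : Fin p → Fin (n + 1) → ℂ} (h : δ.HasCoords A v) :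
    Function.Surjective A.mulVecLin := by
  have h1 := A.mulVecLin.finrank_range_add_finrank_ker
  have h2 := δ.codim_two
  rw [h.1] at h2
  rw [← LinearMap.range_eq_top]
  apply Submodule.eq_top_of_finrank_eq
  simp only [Module.finrank_fintype_fun_eq_card, Fintype.card_fin] at h1 ⊢
  omega

lemma exists_eq_mul_of_ker_eq {m : ℕ} {A B : Matrix (Fin 2) (Fin m) ℂ}
    (hA : Function.Surjective A.mulVecLin)
    (h : LinearMap.ker A.mulVecLin ≤ LinearMap.ker B.mulVecLin) :
    ∃ g : Matrix (Fin 2) (Fin 2) ℂ, B = g * A := by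
  obtain ⟨s, hs⟩ := A.mulVecLin.exists_rightInverse_of_surjective (LinearMap.range_eq_top.2 hA)
  refine ⟨LinearMap.toMatrix' (B.mulVecLin ∘ₗ s), ?_⟩
  apply Matrix.ext_of_mulVec_single
  intro i
  rw [← Matrix.mulVec_mulVec, LinearMap.toMatrix'_mulVec]
  have h1 : Pi.single i 1 - s (A *ᵥ Pi.single i 1) ∈ LinearMap.ker A.mulVecLin := by
    have := LinearMap.congr_fun hs (A *ᵥ Pi.single i 1)
    simp only [LinearMap.comp_apply, Matrix.mulVecLin_apply, LinearMap.id_apply] at this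
    rw [LinearMap.mem_ker, map_sub, Matrix.mulVecLin_apply, Matrix.mulVecLin_apply, this, sub_self]
  have h2 := h h1
  rw [LinearMap.mem_ker, map_sub, sub_eq_zero] at h2
  exact h2

/-- Two systems of coordinates of a datum differ by `GL₂ × (ℂˣ)ᵖ`. -/
lemma Datum.HasCoords.exists_eq_mul {n p : ℕ} {δ : Datum n p}
    {A B : Matrix (Fin 2) (Fin (n + 1)) ℂ} {v w : Fin p → Fin (n + 1) → ℂ}
    (h : δ.HasCoords A v) (h' : δ.HasCoords B w) :
    ∃ (g : Matrix (Fin 2) (Fin 2) ℂ) (c : Fin p → ℂ), g.det ≠ 0 ∧ (∀ i, c i ≠ 0) ∧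
      B = g * A ∧ w = fun i => c i • v i := by
  have hker := h.1.symm.trans h'.1
  obtain ⟨g, hg⟩ := exists_eq_mul_of_ker_eq h.mulVec_surjective hker.le
  have hc : ∀ i, ∃ c : ℂ, c ≠ 0 ∧ w i = c • v i := by
    intro i
    obtain ⟨hv, hvi⟩ := h.2 i
    obtain ⟨hw, hwi⟩ := h'.2 i
    obtain ⟨c, hc⟩ := (Projectivization.mk_eq_mk_iff' ..).1 (hwi.symm.trans hvi)
    exact ⟨c, by rintro rfl; exact hw (by rw [← hc, zero_smul]), hc.symm⟩
  choose c hc0 hc using hc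
  refine ⟨g, c, fun h0 => ?_, hc0, hg, funext hc⟩
  obtain ⟨y, hy0, hy⟩ := Matrix.exists_vecMul_eq_zero_iff.2 h0
  apply hy0
  -- The rows of `B = g * A` are independent since `B` is surjective.
  have hyB : y ᵥ* B = 0 := by rw [hg, ← Matrix.vecMul_vecMul, hy, Matrix.zero_vecMul]
  ext r
  obtain ⟨x, hx⟩ := h'.mulVec_surjective (Pi.single r 1)
  have h1 := Matrix.dotProduct_mulVec y B x
  rw [hyB, zero_dotProduct, ← Matrix.mulVecLin_apply, hx] at h1
  simpa using h1

/-- The data some coordinates of which are not a zero of `f`. -/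
def nonvanishingLocus {n p : ℕ} (f : CoordPoly n p) : Set (Datum n p) :=
  {δ | ∃ A v, δ.HasCoords A v ∧ f.value A v ≠ 0}

lemma exists_value_eq_value_mul {n p : ℕ} (f : CoordPoly n p) (g : Matrix (Fin 2) (Fin 2) ℂ)
    (c : Fin p → ℂ) : ∃ f' : CoordPoly n p, ∀ A v,
      f'.value A v = f.value (g * A) (fun i => c i • v i) := by
  refine ⟨MvPolynomial.bind₁ (Sum.elim (fun q => ∑ r, MvPolynomial.C (g q.1 r) *
    MvPolynomial.X (Sum.inl (r, q.2))) (fun q => MvPolynomial.C (c q.1) *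
    MvPolynomial.X (Sum.inr q))) f, fun A v => ?_⟩
  rw [CoordPoly.value, CoordPoly.value, ← MvPolynomial.aeval_eq_eval, ← MvPolynomial.aeval_eq_eval]
  rw [MvPolynomial.aeval_bind₁]
  congr 2
  ext (q | q) <;> simp [Matrix.mul_apply]

/-- The union of the translates, under changes of coordinates, of the set where `f` does not vanish
is open. -/
lemma isOpen_nonvanishingLocus {n p : ℕ} (f : CoordPoly n p) : IsOpen (nonvanishingLocus f) := by
  refine ⟨{f' | ∃ (g : Matrix (Fin 2) (Fin 2) ℂ) (c : Fin p → ℂ), g.det ≠ 0 ∧ (∀ i, c i ≠ 0) ∧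
    ∀ A v, f'.value A v = f.value (g * A) (fun i => c i • v i)}, fun δ A v hδ => ⟨?_, ?_⟩⟩
  · rintro ⟨B, w, hδ', hf⟩
    obtain ⟨g, c, hg, hc, rfl, rfl⟩ := hδ.exists_eq_mul hδ'
    obtain ⟨f', hf'⟩ := exists_value_eq_value_mul f g c
    exact ⟨f', ⟨g, c, hg, hc, hf'⟩, by rwa [hf']⟩
  · rintro ⟨f', ⟨g, c, hg, hc, hf'⟩, hf⟩
    rw [hf'] at hf
    refine ⟨_, _, ⟨?_, fun i => ?_⟩, hf⟩
    · rw [hδ.1]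
      ext x
      simp only [LinearMap.mem_ker, Matrix.mulVecLin_apply, ← Matrix.mulVec_mulVec]
      exact ⟨fun h => by rw [h, Matrix.mulVec_zero], Matrix.eq_zero_of_mulVec_eq_zero hg⟩
    · obtain ⟨hv, hvi⟩ := hδ.2 i
      refine ⟨smul_ne_zero (hc i) hv, ?_⟩
      rw [hvi, eq_comm, Projectivization.mk_eq_mk_iff']
      exact ⟨c i, rfl⟩

/-- The obstruction as a polynomial in the coordinates of a datum. -/
noncomputable def obstructionPoly (n : ℕ) : CoordPoly n (n + 2) :=
  obstruction (Matrix.of fun r k => MvPolynomial.X (Sum.inl (r, k)))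
    fun i k => MvPolynomial.X (Sum.inr (i, k))

lemma value_obstructionPoly {n : ℕ} (A : Matrix (Fin 2) (Fin (n + 1)) ℂ)
    (v : Fin (n + 2) → Fin (n + 1) → ℂ) : (obstructionPoly n).value A v = obstruction A v := by
  rw [CoordPoly.value, obstructionPoly, map_obstruction]
  congr 1
  · ext r k
    simp
  · ext i k
    simp

/-! ### A datum on the standard rational normal curve -/

/-- The standard parametrization of the rational normal curve of degree `n`. -/
def standardCurve (n : ℕ) (x : Fin 2 → ℂ) (k : Fin (n + 1)) : ℂ := x 0 ^ (n - k : ℕ) * x 1 ^ (k : ℕ)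

/-- Linear forms which cut out on the standard rational normal curve the `n - 1` points with
`x₀ⁿ⁻¹ + x₁ⁿ⁻¹ = 0`. -/
def standardForms (n : ℕ) : Matrix (Fin 2) (Fin (n + 1)) ℂ := Matrix.of fun r k =>
  (if (k : ℕ) = r then 1 else 0) + if (k : ℕ) = n - 1 + r then 1 else 0

/-- The points of the standard rational normal curve with parameters `0, …, n + 1`. -/
def standardPoints (n : ℕ) (i : Fin (n + 2)) (k : Fin (n + 1)) : ℂ := (i : ℂ) ^ (k : ℕ)

lemma standardPoints_eq (n : ℕ) (i : Fin (n + 2)) :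
    standardPoints n i = standardCurve n ![1, (i : ℂ)] := by
  ext k
  simp [standardPoints, standardCurve]

lemma standardCurve_mem (n : ℕ) (k : Fin (n + 1)) :
    (fun x => standardCurve n x k) ∈ binaryForms n := by
  refine mem_binaryForms.2 ⟨MvPolynomial.X 0 ^ (n - k : ℕ) * MvPolynomial.X 1 ^ (k : ℕ), ?_,
    fun u => by simp [standardCurve]⟩
  convert (MvPolynomial.isHomogeneous_X_pow (R := ℂ) (0 : Fin 2) (n - k : ℕ)).mul
    (MvPolynomial.isHomogeneous_X_pow (1 : Fin 2) (k : ℕ)) using 1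
  have := k.2
  omega

lemma standardForms_mulVec_standardCurve {n : ℕ} (hn : 1 ≤ n) (x : Fin 2 → ℂ) :
    standardForms n *ᵥ standardCurve n x = (x 0 ^ (n - 1) + x 1 ^ (n - 1)) • x := by
  obtain ⟨m, rfl⟩ := Nat.exists_eq_add_of_le' hn
  have key : ∀ (j : ℕ) (hj : j < m + 1 + 1), ∑ k : Fin (m + 1 + 1),
      (if (k : ℕ) = j then (1 : ℂ) else 0) * standardCurve (m + 1) x k =
        x 0 ^ (m + 1 - j) * x 1 ^ j := by
    intro j hj
    rw [Finset.sum_eq_single ⟨j, hj⟩]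
    · simp [standardCurve]
    · intro k _ hk
      rw [if_neg fun h => hk (Fin.ext h), zero_mul]
    · simp
  ext r
  simp only [Matrix.mulVec, dotProduct, standardForms, Matrix.of_apply, add_mul,
    Finset.sum_add_distrib, Pi.smul_apply, smul_eq_mul, Nat.add_sub_cancel]
  rw [key _ (by omega), key _ (by omega)]
  fin_cases r
  · simp
    ring
  · simp
    ring

lemma one_add_natCast_pow_ne_zero (i m : ℕ) : (1 : ℂ) + (i : ℂ) ^ m ≠ 0 := by
  have : (1 + i ^ m : ℕ) ≠ 0 := by omega
  exact_mod_cast this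

lemma standardForms_mulVec_standardPoints {n : ℕ} (hn : 1 ≤ n) (i : Fin (n + 2)) :
    standardForms n *ᵥ standardPoints n i = (1 + (i : ℂ) ^ (n - 1)) • ![1, (i : ℂ)] := by
  rw [standardPoints_eq, standardForms_mulVec_standardCurve hn]
  simp

lemma bracket_standard_ne_zero {n : ℕ} (hn : 1 ≤ n) (i j : Fin (n + 2)) (hij : i ≠ j) :
    bracket (standardForms n *ᵥ standardPoints n i) (standardForms n *ᵥ standardPoints n j) ≠ 0 := by
  rw [standardForms_mulVec_standardPoints hn, standardForms_mulVec_standardPoints hn,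
    bracket_smul_left, bracket_smul_right]
  refine mul_ne_zero (one_add_natCast_pow_ne_zero _ _) (mul_ne_zero
    (one_add_natCast_pow_ne_zero _ _) ?_)
  simp only [bracket, Matrix.cons_val_zero, Matrix.cons_val_one, one_mul, mul_one]
  rw [sub_ne_zero]
  intro h
  exact hij (Fin.ext (by exact_mod_cast h.symm))

lemma standardCurve_interpolates {n : ℕ} (hn : 1 ≤ n) :
    Interpolates (standardPoints n) (fun i => standardForms n *ᵥ standardPoints n i)
      (standardCurve n) where
  mem := standardCurve_mem n
  apply_eq i := by
    refine ⟨(1 + (i : ℂ) ^ (n - 1)) ^ n, pow_ne_zero _ (one_add_natCast_pow_ne_zero _ _), ?_⟩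
    ext k
    rw [standardForms_mulVec_standardPoints hn, binaryForms_smul (standardCurve_mem n k),
      standardPoints_eq, Pi.smul_apply, smul_eq_mul]

lemma frame_standardPoints (n : ℕ) :
    frame (standardPoints n) = (Matrix.vandermonde fun i : Fin (n + 1) => (i : ℂ))ᵀ := by
  ext k i
  simp [frame, standardPoints, Matrix.vandermonde_apply]

lemma det_frame_standardPoints_ne_zero (n : ℕ) : (frame (standardPoints n)).det ≠ 0 := by
  rw [frame_standardPoints, Matrix.det_transpose, Matrix.det_vandermonde_ne_zero_iff]
  intro i j h
  exact Fin.ext (Nat.cast_injective h)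

lemma weight_standardPoints_ne_zero (n : ℕ) (i : Fin (n + 1)) :
    weight (standardPoints n) i ≠ 0 := by
  have h1 : (frame (standardPoints n)).updateCol i (standardPoints n (Fin.last _)) =
      (Matrix.vandermonde fun j : Fin (n + 1) =>
        ((if j = i then n + 1 else (j : ℕ) : ℕ) : ℂ))ᵀ := by
    ext k j
    by_cases hj : j = i
    · subst hj
      simp [standardPoints, Matrix.vandermonde_apply]
    · simp [hj, frame, standardPoints, Matrix.vandermonde_apply]
  rw [weight, Matrix.cramer_apply, h1, Matrix.det_transpose, Matrix.det_vandermonde_ne_zero_iff]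
  intro j k h
  have h2 : (if j = i then n + 1 else (j : ℕ)) = if k = i then n + 1 else (k : ℕ) := by
    exact Nat.cast_injective h
  have := j.2
  have := k.2
  split_ifs at h2 <;> omega

lemma separable_X_pow_add_X {n : ℕ} (hn : 2 ≤ n) :
    (Polynomial.X ^ n + Polynomial.X : Polynomial ℂ).Separable := by
  obtain ⟨m, rfl⟩ := Nat.exists_eq_add_of_le' hn
  have h1 : (Polynomial.X ^ (m + 2) + Polynomial.X : Polynomial ℂ) =
      Polynomial.X * (Polynomial.X ^ (m + 1) - Polynomial.C (-1)) := by
    simp only [map_neg, Polynomial.C_1]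
    ring
  rw [h1]
  refine Polynomial.separable_X.mul (Polynomial.separable_X_pow_sub_C _ ?_ (by simp)) ?_
  · exact_mod_cast Nat.succ_ne_zero m
  · refine ⟨-Polynomial.X ^ m, 1, ?_⟩
    simp only [map_neg, Polynomial.C_1]
    ring

lemma obstruction_standard_ne_zero {n : ℕ} (hn : 2 ≤ n) :
    obstruction (standardForms n) (standardPoints n) ≠ 0 := by
  have hn1 : 1 ≤ n := by omega
  have hv := det_frame_standardPoints_ne_zero n
  have hw := weight_standardPoints_ne_zero n
  have hA := bracket_standard_ne_zero hn1
  obtain ⟨a, ha, hcurve⟩ := (curve_interpolates hv hw hA).exists_eq_smul hv hA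
    (standardCurve_interpolates hn1)
  -- The explicit curve is the standard one, for which `A ∘ Φ` is known.
  have hcontact : contact (standardForms n) (standardPoints n) =
      Polynomial.C (-a) * (Polynomial.X ^ n + Polynomial.X) := by
    refine Polynomial.funext fun t => ?_
    rw [eval_contact, hcurve, Matrix.mulVec_smul, standardForms_mulVec_standardCurve hn1,
      standardForms_mulVec_standardPoints hn1]
    obtain ⟨m, rfl⟩ := Nat.exists_eq_add_of_le' hn
    simp [bracket]
    left
    ring
  have hdeg : (Polynomial.X ^ n + Polynomial.X : Polynomial ℂ).natDegree = n := by
    compute_degree!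
    rw [if_neg (by omega)]; simp
  have hsep := separable_X_pow_add_X hn
  have hsep' : (contact (standardForms n) (standardPoints n)).Separable := by
    rw [hcontact]
    exact hsep.unit_mul (Polynomial.isUnit_C.2 (isUnit_iff_ne_zero.2 (neg_ne_zero.2 ha)))
  have hdeg' : (contact (standardForms n) (standardPoints n)).natDegree = n := by
    rw [hcontact, Polynomial.natDegree_C_mul (neg_ne_zero.2 ha), hdeg]
  refine mul_ne_zero (mul_ne_zero (mul_ne_zero (mul_ne_zero hv ?_) ?_) ?_) ?_
  · exact Finset.prod_ne_zero_iff.2 fun i _ => hw i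
  · exact Finset.prod_ne_zero_iff.2 fun i _ => Finset.prod_ne_zero_iff.2 fun j hj =>
      hA i j (Finset.ne_of_mem_erase hj).symm
  · have h1 := Polynomial.leadingCoeff_ne_zero.2 hsep'.ne_zero
    rwa [Polynomial.leadingCoeff, hdeg'] at h1
  · have h1 := Polynomial.resultant_ne_zero _ _ hsep'
    rwa [Polynomial.natDegree_derivative, hdeg'] at h1

lemma nonvanishingLocus_obstructionPoly_nonempty {n : ℕ} (hn : 2 ≤ n) :
    (nonvanishingLocus (obstructionPoly n)).Nonempty := by
  have hn1 : 1 ≤ n := by omega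
  set A := standardForms n with hAdef
  have hA := bracket_standard_ne_zero hn1
  have hsurj : Function.Surjective A.mulVecLin := by
    intro y
    have h01 := hA 0 1 (by simp)
    rw [← hAdef] at h01
    set β := bracket (A *ᵥ standardPoints n 0) (A *ᵥ standardPoints n 1)
    have h1 : bracket (A *ᵥ standardPoints n 0) (A *ᵥ (β⁻¹ • standardPoints n 1)) = 1 := by
      rw [Matrix.mulVec_smul, bracket_smul_right]
      exact inv_mul_cancel₀ h01
    refine ⟨bracket y (A *ᵥ (β⁻¹ • standardPoints n 1)) • standardPoints n 0 +
      bracket (A *ᵥ standardPoints n 0) y • (β⁻¹ • standardPoints n 1), ?_⟩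
    rw [Matrix.mulVecLin_apply, Matrix.mulVec_add, Matrix.mulVec_smul _ (bracket y _),
      Matrix.mulVec_smul _ (bracket _ y)]
    exact (eq_add_of_bracket_eq_one h1 y).symm
  have hcodim : Module.finrank ℂ (LinearMap.ker A.mulVecLin) + 2 = n + 1 := by
    have h1 := A.mulVecLin.finrank_range_add_finrank_ker
    rw [LinearMap.range_eq_top.2 hsurj, finrank_top] at h1
    simp only [Module.finrank_fintype_fun_eq_card, Fintype.card_fin] at h1
    omega
  have hv : ∀ i, standardPoints n i ≠ 0 := fun i h =>
    ne_zero_of_bracket_ne_zero hA i (by rw [h, Matrix.mulVec_zero])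
  refine ⟨⟨LinearMap.ker A.mulVecLin, hcodim, fun i => Projectivization.mk ℂ _ (hv i)⟩, A,
    standardPoints n, ⟨rfl, fun i => ⟨hv i, rfl⟩⟩, ?_⟩
  rw [value_obstructionPoly]
  exact obstruction_standard_ne_zero hn

end RNC

theorem proposition4p2 (n : ℕ) (hn : 2 ≤ n) :
    ∃ U : Set (RNC.Datum n (n + 2)), IsOpen U ∧ U.Nonempty ∧
      ∀ δ ∈ U, ∃! C : Set (RNC.PSpace n),
        RNC.IsRationalNormalCurve C ∧ (∀ i, δ.point i ∈ C) ∧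
          RNC.IsSecant (n - 1) δ.space C := by
  refine ⟨RNC.nonvanishingLocus (RNC.obstructionPoly n), RNC.isOpen_nonvanishingLocus _,
    RNC.nonvanishingLocus_obstructionPoly_nonempty hn, ?_⟩
  rintro δ ⟨A, v, hδ, hf⟩
  rw [RNC.value_obstructionPoly] at hf
  rw [hδ.1]
  exact RNC.existsUnique_of_obstruction_ne_zero hn hf hδ.2
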